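/- A \emph{flat double category} is a small double category in which squares are uniquely determined by their boundary; we write $\rightarrowtail$ for horizontal and $\twoheadrightarrow$ for vertical morphisms. A \emph{squares category} is a flat double category $\mathbb{A}$ with a distinguished object $O$ that is initial in the underlying horizontal category and terminal in the underlying vertical category $\mathcal{V}_{\mathbb{A}}$. A vertical morphism $w\colon A\twoheadrightarrow B$ is a \emph{vertical weak equivalence} if there is a square in $\mathbb{A}$ with top $O\rightarrowtail A$, bottom $O\rightarrowtail B$, left side $\mathrm{id}_O$ and right side $w$. For $n\ge 0$ let $S^{\square}_n$ be the flat double category generated by the staircase of objects $A_{ij}$ $(0\le i\le j\le n)$, horizontal morphisms $A_{ij}\rightarrowtail A_{i,j+1}$, vertical morphisms $A_{ij}\twoheadrightarrow A_{i+1,j}$ $(i<j)$, and the elementary squares between them. Let $S^{\square}_n\mathbb{A}$ be the category whose objects are the double functors $F\colon S^{\square}_n\to\mathbb{A}$ with $F(A_{ii})=O$ for all $i$, and whose morphisms $F\to G$ are the vertical natural transformations: families of vertical morphisms $F(A_{ij})\twoheadrightarrow G(A_{ij})$ that form squares of $\mathbb{A}$ with the horizontal morphisms and commute in $\mathcal{V}_{\mathbb{A}}$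 with the vertical morphisms. These categories form a simplicial category $S^{\square}_\bullet\mathbb{A}$: a monotone map $\varphi$ acts by precomposition with $A_{ij}\mapsto A_{\varphi(i)\varphi(j)}$. Let $\operatorname{ob}S^{\square}_\bullet\mathbb{A}$ be its simplicial set of objects. Write $|S^{\square}_\bullet\mathbb{A}|$ for the realization of the simplicial category, i.e. the geometric realization of the diagonal $[n]\mapsto N_nS^{\square}_n\mathbb{A}$ of its levelwise nerve, and $|\operatorname{ob}S^{\square}_\bullet\mathbb{A}|$ for the geometric realization of the simplicial set of objects. \textbf{Proposition.} Let $\mathbb{A}$ be a squares category in which a vertical morphism is a vertical weak equivalence if and only if it is an isomorphism in $\mathcal{V}_{\mathbb{A}}$. Then $|S^{\square}_\bullet\mathbb{A}|\simeq|\operatorname{ob}S^{\square}_\bullet\mathbb{A}|$; more precisely, the map $|\operatorname{ob}S^{\square}_\bullet\mathbb{A}|\to|S^{\square}_\bullet\mathbb{A}|$ induced by the inclusion of the objects (as constant chains of identities) is a homotopy equivalence. -/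

import Mathlib

open CategoryTheory

universe u

/-- A (small) flat double category: a horizontal and a vertical category on the same objects,
together with squares. As squares of a flat double category are uniquely determined by their
boundary, being a square is a property `Sq top bottom left right` of a boundary.
```
  A --f--> B
  |        |
  l        r
  v        v
  A' --g-> B'
```
The associativity, unit and interchange laws for squares hold automatically. -/
structure FlatDoubleCat where
  /-- objects -/
  Obj : Type u
  /-- the underlying horizontal category -/
  hor : Category.{u} Obj
  /-- the underlying vertical category -/
  ver : Category.{u} Obj
  /-- `Sq f g l r`: the boundary with top `f`, bottom `g`, left `l`, right `r` is a square -/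
  Sq : ∀ {A B A' B' : Obj},
    hor.Hom A B → hor.Hom A' B' → ver.Hom A A' → ver.Hom B B' → Prop
  /-- identity squares on vertical morphisms -/
  sq_hid : ∀ {A A' : Obj} (l : ver.Hom A A'), Sq (hor.id A) (hor.id A') l l
  /-- identity squares on horizontal morphisms -/
  sq_vid : ∀ {A B : Obj} (f : hor.Hom A B), Sq f f (ver.id A) (ver.id B)
  /-- horizontal composition of squares -/
  sq_hcomp : ∀ {A B C A' B' C' : Obj} {f : hor.Hom A B} {g : hor.Hom B C}
    {f' : hor.Hom A' B'} {g' : hor.Hom B' C'}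
    {l : ver.Hom A A'} {m : ver.Hom B B'} {r : ver.Hom C C'},
    Sq f f' l m → Sq g g' m r → Sq (hor.comp f g) (hor.comp f' g') l r
  /-- vertical composition of squares -/
  sq_vcomp : ∀ {A B A' B' A'' B'' : Obj} {f : hor.Hom A B} {f' : hor.Hom A' B'}
    {f'' : hor.Hom A'' B''} {l : ver.Hom A A'} {l' : ver.Hom A' A''}
    {r : ver.Hom B B'} {r' : ver.Hom B' B''},
    Sq f f' l r → Sq f' f'' l' r' → Sq f f'' (ver.comp l l') (ver.comp r r')

/-- A squares category: a flat double category with a distinguished object `O` that is initial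
in the horizontal category and terminal in the vertical category. -/
structure SquaresCat extends FlatDoubleCat.{u} where
  /-- the distinguished object -/
  O : Obj
  /-- `O` is horizontally initial -/
  horInitial : Nonempty (@Limits.IsInitial Obj hor O)
  /-- `O` is vertically terminal -/
  verTerminal : Nonempty (@Limits.IsTerminal Obj ver O)

/-- Vertical weak equivalences: the vertical morphisms `w : A ↠ B` that participate in a square
with top `O ↣ A`, bottom `O ↣ B`, left the identity of `O` and right `w`. -/
def SquaresCat.IsVertWeakEquiv (C : SquaresCat.{u}) {A B : C.Obj} (w : C.ver.Hom A B) : Prop :=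
  ∃ (f : C.hor.Hom C.O A) (g : C.hor.Hom C.O B), C.Sq f g (C.ver.id C.O) w

/-- A double functor between flat double categories. -/
structure DoubleFunctor (I : FlatDoubleCat.{0}) (D : FlatDoubleCat.{u}) where
  /-- action on objects -/
  obj : I.Obj → D.Obj
  /-- action on horizontal morphisms -/
  hmap : ∀ {A B : I.Obj}, I.hor.Hom A B → D.hor.Hom (obj A) (obj B)
  /-- action on vertical morphisms -/
  vmap : ∀ {A B : I.Obj}, I.ver.Hom A B → D.ver.Hom (obj A) (obj B)
  hmap_id : ∀ A : I.Obj, hmap (I.hor.id A) = D.hor.id (obj A)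
  hmap_comp : ∀ {A B C : I.Obj} (f : I.hor.Hom A B) (g : I.hor.Hom B C),
    hmap (I.hor.comp f g) = D.hor.comp (hmap f) (hmap g)
  vmap_id : ∀ A : I.Obj, vmap (I.ver.id A) = D.ver.id (obj A)
  vmap_comp : ∀ {A B C : I.Obj} (f : I.ver.Hom A B) (g : I.ver.Hom B C),
    vmap (I.ver.comp f g) = D.ver.comp (vmap f) (vmap g)
  map_sq : ∀ {A B A' B' : I.Obj} {f : I.hor.Hom A B} {g : I.hor.Hom A' B'}
    {l : I.ver.Hom A A'} {r : I.ver.Hom B B'},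
    I.Sq f g l r → D.Sq (hmap f) (hmap g) (vmap l) (vmap r)

/-- Composition of double functors. -/
def DoubleFunctor.comp {I J : FlatDoubleCat.{0}} {D : FlatDoubleCat.{u}}
    (φ : DoubleFunctor I J) (F : DoubleFunctor J D) : DoubleFunctor I D where
  obj A := F.obj (φ.obj A)
  hmap f := F.hmap (φ.hmap f)
  vmap f := F.vmap (φ.vmap f)
  hmap_id A := by rw [φ.hmap_id, F.hmap_id]
  hmap_comp f g := by rw [φ.hmap_comp, F.hmap_comp]
  vmap_id A := by rw [φ.vmap_id, F.vmap_id]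
  vmap_comp f g := by rw [φ.vmap_comp, F.vmap_comp]
  map_sq h := F.map_sq (φ.map_sq h)

/-- A vertical natural transformation between double functors. -/
@[ext]
structure VertNatTrans {I : FlatDoubleCat.{0}} {D : FlatDoubleCat.{u}}
    (F G : DoubleFunctor I D) where
  /-- the vertical components -/
  app : ∀ A : I.Obj, D.ver.Hom (F.obj A) (G.obj A)
  /-- every horizontal morphism yields a square -/
  square : ∀ {A B : I.Obj} (f : I.hor.Hom A B), D.Sq (F.hmap f) (G.hmap f) (app A) (app B)
  /-- naturality with respect to vertical morphisms -/
  naturality : ∀ {A B : I.Obj} (v : I.ver.Hom A B),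
    D.ver.comp (F.vmap v) (app B) = D.ver.comp (app A) (G.vmap v)

/-- The category `Fun^v(I, D)` of double functors and vertical natural transformations. -/
instance funV (I : FlatDoubleCat.{0}) (D : FlatDoubleCat.{u}) :
    Category.{u} (DoubleFunctor I D) where
  Hom F G := VertNatTrans F G
  id F :=
    { app := fun A => D.ver.id (F.obj A)
      square := fun f => D.sq_vid (F.hmap f)
      naturality := fun v => by rw [D.ver.comp_id, D.ver.id_comp] }
  comp {F G H} σ τ :=
    { app := fun A => D.ver.comp (σ.app A) (τ.app A)
      square := fun f => D.sq_vcomp (σ.square f) (τ.square f)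
      naturality := fun v => by
        rw [← D.ver.assoc, σ.naturality, D.ver.assoc, τ.naturality, D.ver.assoc] }
  id_comp σ := by
    apply VertNatTrans.ext
    funext A
    exact D.ver.id_comp _
  comp_id σ := by
    apply VertNatTrans.ext
    funext A
    exact D.ver.comp_id _
  assoc σ τ ρ := by
    apply VertNatTrans.ext
    funext A
    exact D.ver.assoc _ _ _

/-- Precomposition with a double functor, as a functor between the categories `Fun^v`. -/
def precomp {I J : FlatDoubleCat.{0}} (φ : DoubleFunctor I J) (D : FlatDoubleCat.{u}) :
    DoubleFunctor J D ⥤ DoubleFunctor I D where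
  obj F := φ.comp F
  map {F G} (τ : VertNatTrans F G) :=
    { app := fun A => τ.app (φ.obj A)
      square := fun f => τ.square (φ.hmap f)
      naturality := fun v => τ.naturality (φ.vmap v) }
  map_id _ := rfl
  map_comp _ _ := rfl

/-- The staircase shape: objects `A_{ij}` for `0 ≤ i ≤ j ≤ n`; exactly one horizontal morphism
`A_{ij} ↣ A_{ij'}` for `j ≤ j'`, exactly one vertical morphism `A_{ij} ↠ A_{i'j}` for `i ≤ i'`,
no others, and every possible boundary is a square (it is a pasting of elementary ones). -/
def staircase (n : ℕ) : FlatDoubleCat.{0} where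
  Obj := { p : Fin (n + 1) × Fin (n + 1) // p.1 ≤ p.2 }
  hor :=
    { Hom := fun p q => PLift (p.1.1 = q.1.1 ∧ p.1.2 ≤ q.1.2)
      id := fun _ => ⟨rfl, le_rfl⟩
      comp := fun f g => ⟨f.down.1.trans g.down.1, f.down.2.trans g.down.2⟩ }
  ver :=
    { Hom := fun p q => PLift (p.1.1 ≤ q.1.1 ∧ p.1.2 = q.1.2)
      id := fun _ => ⟨le_rfl, rfl⟩
      comp := fun f g => ⟨f.down.1.trans g.down.1, f.down.2.trans g.down.2⟩ }
  Sq := fun _ _ _ _ => True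
  sq_hid := fun _ => trivial
  sq_vid := fun _ => trivial
  sq_hcomp := fun _ _ => trivial
  sq_vcomp := fun _ _ => trivial

/-- The double functor between staircases induced by a monotone map, `A_{ij} ↦ A_{φ(i)φ(j)}`. -/
def staircaseMap {m n : ℕ} (φ : Fin (m + 1) →o Fin (n + 1)) :
    DoubleFunctor (staircase m) (staircase n) where
  obj p := ⟨(φ p.1.1, φ p.1.2), φ.monotone p.2⟩
  hmap f := ⟨congrArg φ f.down.1, φ.monotone f.down.2⟩
  vmap f := ⟨φ.monotone f.down.1, congrArg φ f.down.2⟩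
  hmap_id _ := rfl
  hmap_comp _ _ := rfl
  vmap_id _ := rfl
  vmap_comp _ _ := rfl
  map_sq _ := trivial

/-- The double functors from the staircase that send every diagonal object `A_{ii}` to `O`. -/
def diagonalAtO (C : SquaresCat.{u}) (n : ℕ) :
    ObjectProperty (DoubleFunctor (staircase n) C.toFlatDoubleCat) :=
  fun F => ∀ i : Fin (n + 1), F.obj ⟨(i, i), le_rfl⟩ = C.O

/-- The category `S_n C`: the full subcategory of `Fun^v(staircase n, C)` on the double functors
with `A_{ii} ↦ O` for all `i`. -/
abbrev SCat (C : SquaresCat.{u}) (n : ℕ) : Type u := (diagonalAtO C n).FullSubcategory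

/-- The simplicial operator of `S_• C` attached to a monotone map: precomposition. For a coface
this removes a row and a column, for a codegeneracy it inserts identities. -/
def SCatMap (C : SquaresCat.{u}) {m n : ℕ} (φ : Fin (m + 1) →o Fin (n + 1)) :
    SCat C n ⥤ SCat C m :=
  (diagonalAtO C m).lift
    ((diagonalAtO C n).ι ⋙ precomp (staircaseMap φ) C.toFlatDoubleCat)
    (fun F i => F.property (φ i))

/-- The simplicial category `S_• C`. -/
def SDot (C : SquaresCat.{u}) : SimplicialObject Cat.{u, u} where
  obj n := Cat.of (SCat C n.unop.len)
  map φ := (SCatMap C φ.unop.toOrderHom).toCatHom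
  map_id _ := rfl
  map_comp _ _ := rfl

/-- The simplicial set of objects of a simplicial category. -/
def obSSet (X : SimplicialObject Cat.{u, u}) : SSet.{u} where
  obj n := X.obj n
  map φ := ↾(X.map φ).toFunctor.obj
  map_id n := by
    rw [X.map_id]
    rfl
  map_comp φ ψ := by
    rw [X.map_comp]
    rfl

/-- The diagonal of the levelwise nerve of a simplicial category: its `n`-simplices are the
chains of `n` composable morphisms in the category in degree `n`. -/
def diagNerve (X : SimplicialObject Cat.{u, u}) : SSet.{u} :=
  Functor.diag SimplexCategoryᵒᵖ ⋙ Functor.uncurry.obj (X ⋙ nerveFunctor)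

/-- The inclusion of the objects into the diagonal of the nerve: in degree `n` it sends an object
`x` to the chain `x = x = ⋯ = x` of identities. -/
def obInclusion (X : SimplicialObject Cat.{u, u}) : obSSet X ⟶ diagNerve X where
  app n := ↾fun x => (Functor.const (Fin (n.unop.len + 1))).obj x
  naturality m n φ := by
    ext x
    exact Functor.hext (fun _ => rfl)
      (fun _ _ _ => heq_of_eq ((X.map φ).toFunctor.map_id x).symm)

/-- The geometric realization of a simplicial category: the realization of its bisimplicial
nerve, computed through the diagonal. -/
noncomputable def realizeSCat (X : SimplicialObject Cat.{u, u}) : TopCat.{u} :=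
  SSet.toTop.obj (diagNerve X)

/-- The geometric realization of the simplicial set of objects of a simplicial category. -/
noncomputable def realizeOb (X : SimplicialObject Cat.{u, u}) : TopCat.{u} :=
  SSet.toTop.obj (obSSet X)

/-- The continuous map from the realization of the simplicial set of objects to the realization
of the simplicial category that is induced by the inclusion of objects. -/
noncomputable def realizeObInclusion (X : SimplicialObject Cat.{u, u}) :
    C(realizeOb X, realizeSCat X) :=
  (SSet.toTop.map (obInclusion X)).hom

/-! An `n`-simplex of the diagonal nerve is a chain `F_0 → ⋯ → F_n` in `S_n C`. Its rows can be
mixed: for monotone `θ`, let row `i` be row `i` of `F_{θ i}`. Horizontal morphisms stay inside a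
row, hence inside one `F_k`. Vertical ones go down the rows, so `θ` grows along them, and they are
composed with the transitions of the chain (`mix`).

Taking `θ i = i` gives a simplicial retraction onto the objects, strictly inverse to the inclusion
on one side. For the other side, let `θ` depend also on the position `k` in the new chain: `θ (k, i)
= k` returns the chain, `θ (k, i) = i` the constant chain at its retraction. These two are not
comparable, but both lie below `max k i`, and all three are natural in the simplicial degree. Each
inequality gives a simplicial homotopy (`mixHomotopy`, `switch`), and the resulting zigzag joins the
identity to the retraction followed by the inclusion.

The topological input is `SimplicialHomotopy.homotopic_realization`: simplicial homotopies realize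
to homotopies, by cutting each prism `Δⁿ × Δ¹` into simplices. -/

open Opposite Simplicial

/-! ### Cells of the geometric realization -/

/-- The characteristic map of a simplex of a simplicial set. -/
noncomputable def cell {X : SSet.{u}} {n : SimplexCategory} (x : X.obj (op n)) :
    C(stdSimplex ℝ (Fin (n.len + 1)), SSet.toTop.obj X) :=
  (SSet.toTop.map (SSet.yonedaEquiv.symm x)).hom.comp
    ⟨n.toTopHomeo.symm, n.toTopHomeo.symm.continuous⟩

theorem cell_map {X : SSet.{u}} {m n : SimplexCategory} (φ : m ⟶ n) (x : X.obj (op n))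
    (t : stdSimplex ℝ (Fin (m.len + 1))) :
    cell (X.map φ.op x) t = cell x (stdSimplex.map φ t) := by
  have h : SSet.yonedaEquiv.symm (X.map φ.op x) =
      SSet.stdSimplex.map φ ≫ SSet.yonedaEquiv.symm x := by
    ext k α
    exact (Functor.map_comp_apply X φ.op (SSet.stdSimplex.objEquiv α).op x).symm
  simp only [cell, h, Functor.map_comp, ContinuousMap.comp_apply, ContinuousMap.coe_mk,
    TopCat.hom_comp]
  rw [SimplexCategory.toTopHomeo_symm_naturality_apply]

theorem toTop_map_cell {X Y : SSet.{u}} (f : X ⟶ Y) {n : SimplexCategory} (x : X.obj (op n))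
    (t : stdSimplex ℝ (Fin (n.len + 1))) :
    (SSet.toTop.map f).hom (cell x t) = cell (f.app (op n) x) t := by
  simp only [cell, ← SSet.yonedaEquiv_symm_comp, Functor.map_comp, TopCat.hom_comp,
    ContinuousMap.comp_apply]

theorem sSetTopAdj_homEquiv_app_down {X : SSet.{u}} {Z : TopCat.{u}} (G : SSet.toTop.obj X ⟶ Z)
    (n : SimplexCategory) (x : X.obj (op n)) (t : stdSimplex ℝ (Fin (n.len + 1))) :
    (((sSetTopAdj.homEquiv _ _ G).app (op n) x).down).hom (ULift.up t) = G.hom (cell x t) := by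
  have h : ((sSetTopAdj.homEquiv _ _ G).app (op n) x).down =
      ((sSetTopAdj.unit.app X).app (op n) x).down ≫ G := by
    rw [Adjunction.homEquiv_unit]
    rfl
  rw [h, sSetTopAdj_unit_app_app_down]
  rfl

/-- By the adjunction with the singular complex, a compatible family of maps on cells is a
simplicial map from `X` to the singular complex of `Z`. -/
theorem exists_continuousMap_of_cells {X : SSet.{u}} {Z : Type u} [TopologicalSpace Z]
    (g : ∀ n : SimplexCategory, X.obj (op n) → C(stdSimplex ℝ (Fin (n.len + 1)), Z))
    (hg : ∀ (m n : SimplexCategory) (φ : m ⟶ n) (x : X.obj (op n))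
      (t : stdSimplex ℝ (Fin (m.len + 1))), g m (X.map φ.op x) t = g n x (stdSimplex.map φ t)) :
    ∃ G : C(SSet.toTop.obj X, Z), ∀ (n : SimplexCategory) (x : X.obj (op n))
      (t : stdSimplex ℝ (Fin (n.len + 1))), G (cell x t) = g n x t := by
  let h : X ⟶ TopCat.toSSet.obj (TopCat.of Z) :=
    { app := fun n => ↾fun x =>
        ⟨TopCat.ofHom ((g n.unop x).comp ⟨ULift.down, continuous_uliftDown⟩)⟩
      naturality := by
        intro m n φ
        ext x
        apply ULift.down_injective
        refine TopCat.ext fun t => ?_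
        exact hg _ _ φ.unop x t.down }
  refine ⟨((sSetTopAdj.homEquiv _ _).symm h).hom, fun n x t => ?_⟩
  rw [← sSetTopAdj_homEquiv_app_down, Equiv.apply_symm_apply]
  rfl

theorem continuousMap_ext_of_cells {X : SSet.{u}} {Z : Type u} [TopologicalSpace Z]
    {G G' : C(SSet.toTop.obj X, Z)}
    (h : ∀ (n : SimplexCategory) (x : X.obj (op n))
      (t : stdSimplex ℝ (Fin (n.len + 1))), G (cell x t) = G' (cell x t)) : G = G' := by
  have : TopCat.ofHom (Y := TopCat.of Z) G = TopCat.ofHom G' := by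
    apply (sSetTopAdj.homEquiv _ _).injective
    ext n x
    apply ULift.down_injective
    refine TopCat.ext fun t => ?_
    exact (sSetTopAdj_homEquiv_app_down _ _ _ _).trans
      ((h _ _ _).trans (sSetTopAdj_homEquiv_app_down _ _ _ _).symm)
  exact congrArg TopCat.Hom.hom this

theorem stdSimplex_map_apply {X Y : Type*} [Fintype X] [Fintype Y] [DecidableEq Y] (f : X → Y)
    (s : stdSimplex ℝ X) (y : Y) : stdSimplex.map f s y = ∑ x, if f x = y then s x else 0 := by
  rw [stdSimplex.map_coe, FunOnFinite.linearMap_apply_apply, Finset.sum_filter]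

/-- A point of a simplex already lies in the face spanned by the vertices of nonzero weight, so only
that face of `y` matters. Here `ψ` enumerates these vertices. -/
theorem cell_eq_of_support {Y : SSet.{u}} {m : SimplexCategory} (y y' : Y.obj (op m))
    (t : stdSimplex ℝ (Fin (m.len + 1)))
    (h : ∀ (k : SimplexCategory) (ψ : k ⟶ m), (∀ j, t (ψ j) ≠ 0) →
      Y.map ψ.op y = Y.map ψ.op y') : cell y t = cell y' t := by
  classical
  obtain ⟨c, hc⟩ : ∃ c, (Finset.univ.filter fun i => t i ≠ 0).card = c + 1 := by
    refine Nat.exists_eq_succ_of_ne_zero fun h0 => ?_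
    rw [Finset.card_eq_zero, Finset.filter_eq_empty_iff] at h0
    have h1 := stdSimplex.sum_eq_one t
    simp only [Finset.mem_univ, ne_eq, not_not, forall_const] at h0
    simp [h0] at h1
  let e := (Finset.univ.filter fun i => t i ≠ 0).orderEmbOfFin hc
  have hr : ∀ i, t i ≠ 0 → ∃ j, e j = i := fun i hi => by
    have := Finset.range_orderEmbOfFin (Finset.univ.filter fun i => t i ≠ 0) hc
    have h2 : i ∈ Set.range e := by rw [this]; simpa using hi
    exact h2
  have hsum : ∀ i, (∑ j, if e j = i then t (e j) else 0) = t i := fun i => by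
    by_cases hi : t i = 0
    · rw [hi]
      refine Finset.sum_eq_zero fun j _ => ?_
      split_ifs with hj
      · rw [hj, hi]
      · rfl
    · obtain ⟨j, rfl⟩ := hr i hi
      simp [e.injective.eq_iff]
  let w : stdSimplex ℝ (Fin (c + 1)) := ⟨fun j => t (e j), fun j => stdSimplex.zero_le t _, by
    rw [← stdSimplex.sum_eq_one t]
    calc ∑ j, t (e j) = ∑ j, ∑ i, if e j = i then t (e j) else 0 := by simp
      _ = _ := by rw [Finset.sum_comm]; exact Finset.sum_congr rfl fun i _ => hsum i⟩
  let ψ : ⦋c⦌ ⟶ m := SimplexCategory.Hom.mk e.toOrderHom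
  have hw : stdSimplex.map ψ w = t := by
    ext i
    rw [stdSimplex_map_apply]
    exact hsum i
  rw [← hw, ← cell_map, ← cell_map, h]
  intro j
  exact (Finset.mem_filter.mp
    (Finset.orderEmbOfFin_mem (Finset.univ.filter fun i => t i ≠ 0) hc j)).2

/-! ### Barycentric coordinates and the prism decomposition -/

theorem stdSimplex_map_apply_succAbove {n : ℕ} {Y : Type*} [Fintype Y] [DecidableEq Y]
    (p : Fin (n + 2)) (f : Fin (n + 2) → Y) (s : stdSimplex ℝ (Fin (n + 2))) (y : Y) :
    stdSimplex.map f s y = (if f p = y then s p else 0) +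
      ∑ i, if f (p.succAbove i) = y then s (p.succAbove i) else 0 := by
  rw [stdSimplex_map_apply, Fin.sum_univ_succAbove _ p]

theorem stdSimplex_map_succAbove {n : ℕ} (p : Fin (n + 2)) (s : stdSimplex ℝ (Fin (n + 2)))
    (t : stdSimplex ℝ (Fin (n + 1))) (h0 : s p = 0) (h : ∀ i, s (p.succAbove i) = t i) :
    stdSimplex.map p.succAbove t = s := by
  ext j
  rw [stdSimplex_map_apply]
  induction j using p.succAboveCases with
  | x => rw [h0]; simp [Fin.succAbove_ne]
  | p i => rw [h]; simp

theorem Fin.predAbove_succ_succAbove {n : ℕ} (k i : Fin n) :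
    k.predAbove (k.succ.succAbove i) = i := by
  rcases le_or_gt i k with h | h
  · rw [Fin.succAbove_of_castSucc_lt _ _ (Fin.castSucc_lt_succ_iff.mpr h),
      Fin.predAbove_castSucc_of_le _ _ h]
  · rw [Fin.succAbove_of_le_castSucc _ _ (Fin.succ_le_castSucc_iff.mpr h),
      Fin.predAbove_succ_of_le _ _ h.le]

theorem stdSimplex_map_predAbove_succ {n : ℕ} (k : Fin (n + 1)) (s : stdSimplex ℝ (Fin (n + 2)))
    (i : Fin (n + 1)) : stdSimplex.map k.predAbove s i =
      (if k = i then s k.succ else 0) + s (k.succ.succAbove i) := by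
  rw [stdSimplex_map_apply_succAbove k.succ]
  simp [Fin.predAbove_succ_succAbove]

theorem stdSimplex_map_predAbove_castSucc {n : ℕ} (k : Fin (n + 1))
    (s : stdSimplex ℝ (Fin (n + 2))) (i : Fin (n + 1)) : stdSimplex.map k.predAbove s i =
      (if k = i then s k.castSucc else 0) + s (k.castSucc.succAbove i) := by
  rw [stdSimplex_map_apply_succAbove k.castSucc]
  simp [Fin.predAbove_succAbove]

/-- The map `⦋m⦌ ⟶ ⦋1⦌` that sends exactly the vertices above `k` to `1`. -/
def cut (m k : ℕ) : ⦋m⦌ ⟶ ⦋1⦌ :=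
  SimplexCategory.Hom.mk
    { toFun := fun j => if k < (j : ℕ) then 1 else 0
      monotone' := fun i j hij => by
        have : (i : ℕ) ≤ j := hij
        dsimp only
        split_ifs <;> first | omega | simp }

theorem cut_apply (m k : ℕ) (j : Fin (m + 1)) : cut m k j = if k < (j : ℕ) then 1 else 0 := rfl

theorem stdSimplex_map_cut_one {n : ℕ} (k : Fin (n + 1)) (s : stdSimplex ℝ (Fin (n + 2))) :
    stdSimplex.map (cut (n + 1) k) s 1 =
      s k.succ + ∑ i, if k < i then s (k.succ.succAbove i) else 0 := by
  rw [stdSimplex_map_apply_succAbove k.succ]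
  have h : ∀ i : Fin (n + 1), (k : ℕ) < (k.succ.succAbove i : Fin (n + 2)) ↔ k < i := fun i => by
    rcases lt_or_ge i.castSucc k.succ with hi | hi
    · rw [Fin.succAbove_of_castSucc_lt _ _ hi]; simp
    · rw [Fin.succAbove_of_le_castSucc _ _ hi]
      have h1 : (k : ℕ) + 1 ≤ i := hi
      have h2 : k < i := h1
      simp only [Fin.val_succ, h2, iff_true]
      omega
  simp [cut_apply, h]

theorem stdSimplex_map_cut_one' {n : ℕ} (k : Fin (n + 1)) (s : stdSimplex ℝ (Fin (n + 2))) :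
    stdSimplex.map (cut (n + 1) k) s 1 =
      s k.succ + ∑ i, if k < i then stdSimplex.map k.predAbove s i else 0 := by
  rw [stdSimplex_map_cut_one]
  congr 1
  refine Finset.sum_congr rfl fun i _ => ?_
  split_ifs with h
  · rw [stdSimplex_map_predAbove_succ, if_neg h.ne, zero_add]
  · rfl

/-- The tail sums `V` of `t` decrease from `1` to `0`, so `s 1` falls between `V (k + 1)` and `V k`
for some `k`. The weight `t k` is then split between the vertices `(k, 0)` and `(k, 1)`, the latter
receiving the excess `c = s 1 - V (k + 1)`. -/
theorem exists_prism_coordinates {n : ℕ} (t : stdSimplex ℝ (Fin (n + 1)))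
    (s : stdSimplex ℝ (Fin 2)) : ∃ (k : Fin (n + 1)) (v : stdSimplex ℝ (Fin (n + 2))),
      stdSimplex.map k.predAbove v = t ∧ stdSimplex.map (cut (n + 1) k) v = s := by
  let V : ℕ → ℝ := fun j => ∑ i : Fin (n + 1), if j ≤ i then t i else 0
  have hV0 : V 0 = 1 := by simp [V]
  have hVn : V (n + 1) = 0 := Finset.sum_eq_zero fun i _ => if_neg (by omega)
  have hV : ∀ k : Fin (n + 1), V k = V (k + 1) + t k := fun k => by
    have : t k = ∑ i, if k = i then t i else 0 := by simp
    rw [this, ← Finset.sum_add_distrib]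
    refine Finset.sum_congr rfl fun i _ => ?_
    have := @Fin.ext_iff _ k i
    split_ifs <;> first | omega | simp
  obtain ⟨k, hk1, hk2⟩ : ∃ k : Fin (n + 1), V (k + 1) ≤ s 1 ∧ s 1 ≤ V k := by
    classical
    have hex : ∃ j, V (j + 1) ≤ s 1 := ⟨n, by rw [hVn]; exact stdSimplex.zero_le s 1⟩
    have hle : Nat.find hex ≤ n := Nat.find_min' hex (by rw [hVn]; exact stdSimplex.zero_le s 1)
    refine ⟨⟨Nat.find hex, by omega⟩, Nat.find_spec hex, ?_⟩
    change s 1 ≤ V (Nat.find hex)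
    rcases h : Nat.find hex with _ | j
    · simp [hV0]
    · exact (not_le.mp (Nat.find_min hex (m := j) (by omega))).le
  set c := s 1 - V (k + 1) with hc
  have hck : c ≤ t k := by linarith [hV k]
  let v : Fin (n + 2) → ℝ :=
    k.succ.insertNth (α := fun _ => ℝ) c (fun i => t i - if k = i then c else 0)
  have hv1 : v k.succ = c := Fin.insertNth_apply_same _ _ _
  have hv2 : ∀ i, v (k.succ.succAbove i) = t i - if k = i then c else 0 := fun i =>
    Fin.insertNth_apply_succAbove _ _ _ _
  have hv : v ∈ stdSimplex ℝ (Fin (n + 2)) := by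
    constructor
    · intro j
      induction j using k.succ.succAboveCases with
      | x => rw [hv1]; linarith
      | p i =>
        rw [hv2]
        split_ifs with h
        · subst h; linarith
        · simp
    · rw [Fin.sum_univ_succAbove _ k.succ, hv1]
      simp [hv2]
  have ht : stdSimplex.map k.predAbove ⟨v, hv⟩ = t := by
    ext i
    rw [stdSimplex_map_predAbove_succ]
    change (if k = i then v k.succ else 0) + v (k.succ.succAbove i) = t i
    rw [hv1, hv2]
    ring
  refine ⟨k, ⟨v, hv⟩, ht, ?_⟩
  have h1 : stdSimplex.map (cut (n + 1) k) ⟨v, hv⟩ 1 = s 1 := by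
    rw [stdSimplex_map_cut_one', ht]
    change v k.succ + _ = _
    rw [hv1, hc]
    exact sub_add_cancel _ _
  apply stdSimplexHomeomorphUnitInterval.injective
  exact Subtype.ext h1

/-- The combinatorial prism is covered by its maximal chains, where chain `k` climbs from level `0`
to level `1` over the vertex `k`. -/
theorem exists_factor_prism {n : ℕ} {m : SimplexCategory} (α : m ⟶ ⦋n⦌) (β : m ⟶ ⦋1⦌) :
    ∃ (k : Fin (n + 1)) (γ : m ⟶ ⦋n + 1⦌),
      γ ≫ SimplexCategory.σ k = α ∧ γ ≫ cut (n + 1) k = β := by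
  have hβ : ∀ l, β l = 0 ∨ β l = 1 := fun l => by
    have : ∀ i : Fin 2, i = 0 ∨ i = 1 := by decide
    exact this _
  have hα : ∀ {l l'}, l ≤ l' → α l ≤ α l' := fun h => α.toOrderHom.monotone h
  have hβ' : ∀ {l l'}, l ≤ l' → β l ≤ β l' := fun h => β.toOrderHom.monotone h
  -- The crossing happens at `α l₀` for the least `l₀` on level `1`, or at the last vertex if level
  -- `1` is never reached.
  obtain ⟨k, hk0, hk1⟩ : ∃ k : Fin (n + 1), (∀ l, β l = 0 → α l ≤ k) ∧
      (∀ l, β l = 1 → k ≤ α l) := by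
    by_cases h : ∃ l, β l = 1
    · classical
      obtain ⟨l₀, h₀, hmin⟩ := WellFounded.has_min (wellFounded_lt (α := Fin (m.len + 1)))
        {l | β l = 1} h
      refine ⟨α l₀, fun l hl => hα ?_, fun l hl => hα (not_lt.mp (hmin l hl))⟩
      by_contra! hlt
      have := hβ' hlt.le
      rw [hl, show β l₀ = 1 from h₀] at this
      exact absurd this (by decide)
    · exact ⟨Fin.last n, fun l _ => Fin.le_last _, fun l hl => absurd ⟨l, hl⟩ h⟩
  let γ : m ⟶ ⦋n + 1⦌ := SimplexCategory.Hom.mk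
    { toFun := fun l => if β l = 0 then (α l).castSucc else (α l).succ
      monotone' := fun l l' hl => by
        dsimp only
        have h1 := hα hl
        have h2 := hβ' hl
        split_ifs with h3 h4 h4
        · exact h1
        · exact (Fin.castSucc_lt_succ_iff.mpr h1).le
        · rw [h4, (hβ l).resolve_left h3] at h2
          exact absurd h2 (by decide)
        · exact Fin.succ_le_succ_iff.mpr h1 }
  have hγ : ∀ l, γ l = if β l = 0 then (α l).castSucc else (α l).succ := fun _ => rfl
  refine ⟨k, γ, ?_, ?_⟩
  · ext l : 3
    change k.predAbove (γ l) = α l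
    rw [hγ]
    split_ifs with h
    · exact Fin.predAbove_castSucc_of_le _ _ (hk0 l h)
    · exact Fin.predAbove_succ_of_le _ _ (hk1 l ((hβ l).resolve_left h))
  · ext l : 3
    change (if (k : ℕ) < (γ l : Fin (n + 2)) then (1 : Fin 2) else 0) = β l
    rw [hγ]
    split_ifs with h1 h2 h2
    · exact absurd (hk0 l h1) (not_le.mpr h2)
    · exact h1.symm
    · exact ((hβ l).resolve_left h1).symm
    · exact absurd (Nat.lt_succ_of_le (Fin.le_def.mp (hk1 l ((hβ l).resolve_left h1)))) h2

/-- The decomposition of the prism `Δⁿ × Δ¹` into `n + 1` simplices of dimension `n + 1`. -/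
noncomputable def prismProjection (n : ℕ) : C((_ : Fin (n + 1)) × stdSimplex ℝ (Fin (n + 2)),
    stdSimplex ℝ (Fin (n + 1)) × stdSimplex ℝ (Fin 2)) :=
  ⟨fun p => (stdSimplex.map p.1.predAbove p.2,
      stdSimplex.map (fun j : Fin (n + 2) => if (p.1 : ℕ) < j then (1 : Fin 2) else 0) p.2),
    continuous_sigma fun k => Continuous.prodMk (stdSimplex.continuous_map (S := ℝ) k.predAbove)
      (stdSimplex.continuous_map (S := ℝ)
        (fun j : Fin (n + 2) => if (k : ℕ) < j then (1 : Fin 2) else 0))⟩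

theorem isQuotientMap_prismProjection (n : ℕ) : Topology.IsQuotientMap (prismProjection n) := by
  have hsurj : Function.Surjective (prismProjection n) := fun ⟨t, s⟩ => by
    obtain ⟨k, v, h1, h2⟩ := exists_prism_coordinates t s
    exact ⟨⟨k, v⟩, Prod.ext h1 h2⟩
  -- A continuous map from a compact space to a Hausdorff space is closed.
  have hcl : IsClosedMap (prismProjection n) := (prismProjection n).continuous.isClosedMap
  exact hcl.isQuotientMap (prismProjection n).continuous hsurj

/-! ### Realization of simplicial homotopies -/

/-- A homotopy of maps of simplicial sets, as a natural family of operations: every simplex of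
`X` and every simplex of `Δ[1]` of the same dimension give a simplex of `Y`. -/
structure SimplicialHomotopy (X Y : SSet.{u}) where
  /-- the value on a simplex of `X` and a simplex of `Δ[1]` -/
  app : ∀ n : SimplexCategory, X.obj (op n) → (n ⟶ ⦋1⦌) → Y.obj (op n)
  naturality : ∀ {m n : SimplexCategory} (φ : m ⟶ n) (x : X.obj (op n)) (β : n ⟶ ⦋1⦌),
    app m (X.map φ.op x) (φ ≫ β) = Y.map φ.op (app n x β)

namespace SimplicialHomotopy

variable {X Y : SSet.{u}} (H : SimplicialHomotopy X Y)

/-- The image in the realization of `Y` of a point of the simplex that the pair `(α, β)` spans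
in the prism over a simplex of `X`. -/
noncomputable def point {n : SimplexCategory} (x : X.obj (op n)) {m : SimplexCategory}
    (α : m ⟶ n) (β : m ⟶ ⦋1⦌) : C(stdSimplex ℝ (Fin (m.len + 1)), SSet.toTop.obj Y) :=
  cell (H.app m (X.map α.op x) β)

theorem point_comp {n : SimplexCategory} (x : X.obj (op n)) {l m : SimplexCategory}
    (γ : l ⟶ m) (α : m ⟶ n) (β : m ⟶ ⦋1⦌) (t : stdSimplex ℝ (Fin (l.len + 1))) :
    H.point x (γ ≫ α) (γ ≫ β) t = H.point x α β (stdSimplex.map γ t) := by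
  rw [point, point, ← cell_map, ← H.naturality, op_comp, Functor.map_comp_apply]

theorem point_map {m n : SimplexCategory} (φ : m ⟶ n) (x : X.obj (op n)) {l : SimplexCategory}
    (α : l ⟶ m) (β : l ⟶ ⦋1⦌) :
    H.point (X.map φ.op x) α β = H.point x (α ≫ φ) β := by
  rw [point, point, op_comp, Functor.map_comp_apply]

theorem point_eq_of_support {n : SimplexCategory} (x : X.obj (op n)) {m : SimplexCategory}
    (α α' : m ⟶ n) (β β' : m ⟶ ⦋1⦌) (t : stdSimplex ℝ (Fin (m.len + 1)))
    (h : ∀ j, t j ≠ 0 → α j = α' j ∧ β j = β' j) : H.point x α β t = H.point x α' β' t := by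
  refine cell_eq_of_support _ _ _ fun k ψ hψ => ?_
  have h1 : ψ ≫ α = ψ ≫ α' := by
    ext j : 3
    exact (h _ (hψ j)).1
  have h2 : ψ ≫ β = ψ ≫ β' := by
    ext j : 3
    exact (h _ (hψ j)).2
  rw [← H.naturality, ← H.naturality, ← Functor.map_comp_apply, ← Functor.map_comp_apply,
    ← op_comp, ← op_comp, h1, h2]

/-- A point common to the simplices `k < k'` of the prism lies in their common face: it has no
weight on `(k, 1)`, on `(k', 0)`, or over the vertices strictly between. On the remaining vertices
the two parametrizations agree. -/
theorem point_prism_eq_of_lt {n : ℕ} (x : X.obj (op ⦋n⦌)) {k k' : Fin (n + 1)} (hk : k < k')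
    (v v' : stdSimplex ℝ (Fin (n + 2)))
    (ht : stdSimplex.map k.predAbove v = stdSimplex.map k'.predAbove v')
    (hs : stdSimplex.map (cut (n + 1) k) v = stdSimplex.map (cut (n + 1) k') v') :
    H.point x (SimplexCategory.σ k) (cut (n + 1) k) v =
      H.point x (SimplexCategory.σ k') (cut (n + 1) k') v' := by
  set t := stdSimplex.map k.predAbove v with htv
  have e1 := stdSimplex_map_cut_one' k v
  have e2 := stdSimplex_map_cut_one' k' v'
  rw [← htv] at e1
  rw [← hs, e1, ← ht] at e2
  have hvk := stdSimplex.zero_le v k.succ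
  have hvk' := stdSimplex.zero_le v' k'.castSucc
  have htk' : t k' = v' k'.castSucc + v' k'.succ := by
    rw [ht, stdSimplex_map_predAbove_succ, if_pos rfl, Fin.succAbove_succ_self, add_comm]
  -- This is the difference of the two expressions for the `Δ¹`-coordinate; all its terms are
  -- nonnegative, so each vanishes.
  have hsum : ∑ i, (if k < i ∧ i < k' then t i else 0) + v k.succ + v' k'.castSucc = 0 := by
    have : ∑ i, (if k < i then t i else 0) = ∑ i, (if k < i ∧ i < k' then t i else 0) +
        ∑ i, (if k' = i then t i else 0) + ∑ i, (if k' < i then t i else 0) := by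
      rw [← Finset.sum_add_distrib, ← Finset.sum_add_distrib]
      refine Finset.sum_congr rfl fun i _ => ?_
      split_ifs <;> first | omega | simp
    simp only [Finset.sum_ite_eq, Finset.mem_univ, if_true] at this
    linarith
  have hnn : ∀ i : Fin (n + 1), 0 ≤ if k < i ∧ i < k' then t i else 0 := fun i => by
    split_ifs
    · exact stdSimplex.zero_le t i
    · exact le_rfl
  have hnn' := Finset.sum_nonneg fun i (_ : i ∈ Finset.univ) => hnn i
  have h0 : v k.succ = 0 := by linarith
  have h0' : v' k'.castSucc = 0 := by linarith
  have hmid : ∀ i, k < i → i < k' → t i = 0 := fun i h1 h2 => by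
    have := (Finset.sum_eq_zero_iff_of_nonneg fun i _ => hnn i).mp (by linarith) i
      (Finset.mem_univ i)
    rwa [if_pos ⟨h1, h2⟩] at this
  have hv : stdSimplex.map (SimplexCategory.δ k.succ) t = v :=
    stdSimplex_map_succAbove _ _ _ h0 fun i => by
      rw [htv, stdSimplex_map_predAbove_succ, h0, ite_self, zero_add]
  have hv' : stdSimplex.map (SimplexCategory.δ k'.castSucc) t = v' :=
    stdSimplex_map_succAbove _ _ _ h0' fun i => by
      rw [ht, stdSimplex_map_predAbove_castSucc, h0', ite_self, zero_add]
  rw [← hv, ← hv', ← point_comp, ← point_comp]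
  refine H.point_eq_of_support _ _ _ _ _ _ fun j hj => ⟨?_, ?_⟩
  · change k.predAbove (k.succ.succAbove j) = k'.predAbove (k'.castSucc.succAbove j)
    rw [Fin.predAbove_succ_succAbove, Fin.predAbove_succAbove]
  · change (if (k : ℕ) < (k.succ.succAbove j : Fin (n + 2)) then (1 : Fin 2) else 0) =
      (if (k' : ℕ) < (k'.castSucc.succAbove j : Fin (n + 2)) then (1 : Fin 2) else 0)
    have := fun h1 h2 => hj (hmid j h1 h2)
    simp only [Fin.succAbove, Fin.lt_def, Fin.val_castSucc, Fin.val_succ] at this hk ⊢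
    split_ifs <;> first | rfl | simp_all
    all_goals omega

theorem point_prism_eq {n : ℕ} (x : X.obj (op ⦋n⦌)) (k k' : Fin (n + 1))
    (v v' : stdSimplex ℝ (Fin (n + 2)))
    (ht : stdSimplex.map k.predAbove v = stdSimplex.map k'.predAbove v')
    (hs : stdSimplex.map (cut (n + 1) k) v = stdSimplex.map (cut (n + 1) k') v') :
    H.point x (SimplexCategory.σ k) (cut (n + 1) k) v =
      H.point x (SimplexCategory.σ k') (cut (n + 1) k') v' := by
  rcases lt_trichotomy k k' with h | rfl | h
  · exact H.point_prism_eq_of_lt x h v v' ht hs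
  · have hc : v k.succ = v' k.succ := by
      have e1 := stdSimplex_map_cut_one' k v
      have e2 := stdSimplex_map_cut_one' k v'
      rw [hs, ht, e2] at e1
      linarith
    congr 1
    ext j
    induction j using k.succ.succAboveCases with
    | x => exact hc
    | p i =>
      have := DFunLike.congr_fun ht i
      rwa [stdSimplex_map_predAbove_succ, stdSimplex_map_predAbove_succ, hc,
        add_right_inj] at this
  · exact (H.point_prism_eq_of_lt x h v' v ht.symm hs.symm).symm

/-- Both pairs factor through maximal simplices of the prism, which reduces the claim to
`point_prism_eq`. -/
theorem point_eq {n : SimplexCategory} (x : X.obj (op n)) {m m' : SimplexCategory}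
    (α : m ⟶ n) (β : m ⟶ ⦋1⦌) (α' : m' ⟶ n) (β' : m' ⟶ ⦋1⦌)
    (t : stdSimplex ℝ (Fin (m.len + 1))) (t' : stdSimplex ℝ (Fin (m'.len + 1)))
    (ht : stdSimplex.map α t = stdSimplex.map α' t')
    (hs : stdSimplex.map β t = stdSimplex.map β' t') : H.point x α β t = H.point x α' β' t' := by
  induction n using SimplexCategory.rec with | _ n
  obtain ⟨k, γ, rfl, rfl⟩ := exists_factor_prism α β
  obtain ⟨k', γ', rfl, rfl⟩ := exists_factor_prism α' β'
  rw [point_comp, point_comp]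
  refine H.point_prism_eq x k k' _ _ ?_ ?_
  · rw [stdSimplex.map_comp_apply, stdSimplex.map_comp_apply]
    exact ht
  · rw [stdSimplex.map_comp_apply, stdSimplex.map_comp_apply]
    exact hs

theorem exists_prismMap {n : SimplexCategory} (x : X.obj (op n)) :
    ∃ P : C(stdSimplex ℝ (Fin (n.len + 1)) × stdSimplex ℝ (Fin 2), SSet.toTop.obj Y),
      ∀ (m : SimplexCategory) (α : m ⟶ n) (β : m ⟶ ⦋1⦌) (t : stdSimplex ℝ (Fin (m.len + 1))),
        P (stdSimplex.map α t, stdSimplex.map β t) = H.point x α β t := by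
  induction n using SimplexCategory.rec with | _ n
  let q := prismProjection n
  let f : C((_ : Fin (n + 1)) × stdSimplex ℝ (Fin (n + 2)), SSet.toTop.obj Y) :=
    ⟨fun p => H.point x (SimplexCategory.σ p.1) (cut (n + 1) p.1) p.2,
      continuous_sigma fun k =>
      (H.point x (SimplexCategory.σ k) (cut (n + 1) k)).continuous⟩
  have hf : Function.FactorsThrough f q := fun a b hab =>
    H.point_prism_eq x _ _ _ _ (congrArg Prod.fst hab) (congrArg Prod.snd hab)
  obtain ⟨P, hP⟩ : ∃ P : C(stdSimplex ℝ (Fin (n + 1)) × stdSimplex ℝ (Fin 2), SSet.toTop.obj Y),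
      ∀ p, P (q p) = f p :=
    ⟨(isQuotientMap_prismProjection n).lift f hf,
      DFunLike.congr_fun ((isQuotientMap_prismProjection n).lift_comp f hf)⟩
  refine ⟨P, fun m α β t => ?_⟩
  obtain ⟨k, v, h1, h2⟩ := exists_prism_coordinates (stdSimplex.map α t) (stdSimplex.map β t)
  have h3 := hP ⟨k, v⟩
  have h4 : q ⟨k, v⟩ = (stdSimplex.map α t, stdSimplex.map β t) := Prod.ext h1 h2
  rw [h4] at h3
  exact h3.trans (H.point_eq x (SimplexCategory.σ k) (cut (n + 1) k) α β v t h1 h2)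

theorem homotopic_realization (f g : X ⟶ Y)
    (hf : ∀ (n : SimplexCategory) (x : X.obj (op n)),
      H.app n x (SimplexCategory.const n ⦋1⦌ 0) = f.app (op n) x)
    (hg : ∀ (n : SimplexCategory) (x : X.obj (op n)),
      H.app n x (SimplexCategory.const n ⦋1⦌ 1) = g.app (op n) x) :
    (SSet.toTop.map f).hom.Homotopic (SSet.toTop.map g).hom := by
  choose P hP using fun (n : SimplexCategory) (x : X.obj (op n)) => H.exists_prismMap x
  -- Currying puts the homotopy parameter into the target, so the prism maps glue by the universal
  -- property of the realization of `X` alone.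
  obtain ⟨G, hG⟩ := exists_continuousMap_of_cells (X := X)
    (Z := C(stdSimplex ℝ (Fin 2), SSet.toTop.obj Y)) (fun n x => (P n x).curry) (by
      intro m n φ x t
      ext s
      obtain ⟨k, v, rfl, rfl⟩ : ∃ (k : Fin (m.len + 1)) (v : stdSimplex ℝ (Fin (m.len + 2))),
        stdSimplex.map k.predAbove v = t ∧ stdSimplex.map (cut (m.len + 1) k) v = s :=
          -- Writing `(t, s)` as the image of a point of one simplex makes both prism maps
          -- computable through `hP`.
          exists_prism_coordinates t s
      have h1 := hP m (X.map φ.op x) _ (SimplexCategory.σ k) (cut (m.len + 1) k) v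
      have h2 := hP n x _ (SimplexCategory.σ k ≫ φ) (cut (m.len + 1) k) v
      rw [point_map, ← h2] at h1
      refine h1.trans ?_
      rw [ContinuousMap.curry_apply, stdSimplex.map_comp_apply]
      rfl)
  have hend : ∀ (i : Fin 2) (e : X ⟶ Y), (∀ (n : SimplexCategory) (x : X.obj (op n)),
      H.app n x (SimplexCategory.const n ⦋1⦌ i) = e.app (op n) x) →
      ∀ p, G p (stdSimplex.vertex i) = (SSet.toTop.map e).hom p := by
    intro i e he p
    let ev : C(SSet.toTop.obj X, SSet.toTop.obj Y) :=
      ⟨fun p => G p (stdSimplex.vertex i), by fun_prop⟩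
    change ev p = _
    congr 1
    refine continuousMap_ext_of_cells fun n x t => ?_
    change G (cell x t) _ = _
    rw [hG, toTop_map_cell, ← he, ContinuousMap.curry_apply]
    have h1 := hP n x _ (𝟙 n) (SimplexCategory.const n ⦋1⦌ i) t
    have h2 : stdSimplex.map (SimplexCategory.const n ⦋1⦌ i) t = stdSimplex.vertex (S := ℝ) i := by
      ext j
      rw [stdSimplex_map_apply]
      change ∑ l, (if i = j then t l else 0) = (Pi.single i 1 : Fin 2 → ℝ) j
      by_cases hij : i = j
      · subst hij; simp
      · simp [hij, Ne.symm hij]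
    have h3 : stdSimplex.map (𝟙 n : n ⟶ n) t = t := stdSimplex.map_id_apply t
    rw [h2, h3] at h1
    rw [h1, point]
    simp
  refine ⟨⟨⟨fun p => G p.2 (stdSimplexHomeomorphUnitInterval.symm p.1), by fun_prop⟩,
    fun p => ?_, fun p => ?_⟩⟩
  · rw [← hend 0 f hf]
    change G p _ = _
    congr 1
    exact (Homeomorph.symm_apply_eq _).mpr stdSimplexHomeomorphUnitInterval_zero.symm
  · rw [← hend 1 g hg]
    change G p _ = _
    congr 1
    exact (Homeomorph.symm_apply_eq _).mpr stdSimplexHomeomorphUnitInterval_one.symm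

end SimplicialHomotopy

/-! ### Mixing the rows of a chain of double functors -/

section Mixing

variable {D : FlatDoubleCat.{u}} {n : ℕ} {K : Type} [Preorder K]

/-- The horizontal morphisms of a family of double functors, for equal parameters. -/
def mixHor (F : K ⥤ DoubleFunctor (staircase n) D) {k l : K} (h : k = l)
    {A B : (staircase n).Obj} (f : (staircase n).hor.Hom A B) :
    D.hor.Hom ((F.obj k).obj A) ((F.obj l).obj B) :=
  -- In `mix` the parameters at the two ends of a horizontal morphism agree only propositionally,
  -- hence the transport; with `h` general it can be removed by `subst`.
  cast (congrArg (fun l => D.hor.Hom ((F.obj k).obj A) ((F.obj l).obj B)) h) ((F.obj k).hmap f)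

/-- The vertical morphisms of a chain of double functors, with increasing parameter. -/
def mixVer (F : K ⥤ DoubleFunctor (staircase n) D) {k l : K} (h : k ≤ l)
    {A B : (staircase n).Obj} (v : (staircase n).ver.Hom A B) :
    D.ver.Hom ((F.obj k).obj A) ((F.obj l).obj B) :=
  D.ver.comp ((F.obj k).vmap v) (VertNatTrans.app (F.map (homOfLE h)) B)

variable (F : K ⥤ DoubleFunctor (staircase n) D)

theorem map_homOfLE_refl_app {k : K} (h : k ≤ k) (A : (staircase n).Obj) :
    VertNatTrans.app (F.map (homOfLE h)) A = D.ver.id _ := by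
  rw [show homOfLE h = 𝟙 k from rfl, F.map_id]
  rfl

theorem map_homOfLE_comp_app {k l m : K} (h : k ≤ l) (h' : l ≤ m) (A : (staircase n).Obj) :
    D.ver.comp (VertNatTrans.app (F.map (homOfLE h)) A) (VertNatTrans.app (F.map (homOfLE h')) A) =
      VertNatTrans.app (F.map (homOfLE (h.trans h'))) A := by
  rw [← homOfLE_comp h h', F.map_comp]
  rfl

theorem mixVer_refl {k : K} (h : k ≤ k) {A B : (staircase n).Obj}
    (v : (staircase n).ver.Hom A B) : mixVer F h v = (F.obj k).vmap v := by
  rw [mixVer, map_homOfLE_refl_app, D.ver.comp_id]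

theorem mixHor_comp {k l m : K} (h : k = l) (h' : l = m) {A B E : (staircase n).Obj}
    (f : (staircase n).hor.Hom A B) (g : (staircase n).hor.Hom B E) :
    D.hor.comp (mixHor F h f) (mixHor F h' g) =
      mixHor F (h.trans h') ((staircase n).hor.comp f g) := by
  subst h h'
  exact ((F.obj k).hmap_comp f g).symm

/-- Naturality of the transition from `k` to `l` slides it past `w`, after which the two transitions
compose. -/
theorem mixVer_comp {k l m : K} (h : k ≤ l) (h' : l ≤ m) {A B E : (staircase n).Obj}
    (v : (staircase n).ver.Hom A B) (w : (staircase n).ver.Hom B E) :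
    D.ver.comp (mixVer F h v) (mixVer F h' w) =
      mixVer F (h.trans h') ((staircase n).ver.comp v w) := by
  have hn := VertNatTrans.naturality (F.map (homOfLE h)) w
  simp only [mixVer]
  rw [(F.obj k).vmap_comp, ← map_homOfLE_comp_app F h h', D.ver.assoc, D.ver.assoc,
    ← D.ver.assoc (VertNatTrans.app _ _), ← hn, D.ver.assoc]

/-- The square is pasted from a square of `F.obj k` on top and the square of the transition on `g`
below. -/
theorem mix_sq {k l k' l' : K} (h : k = l) (h' : k' = l') (hk : k ≤ k') (hl : l ≤ l')
    {A B A' B' : (staircase n).Obj} (f : (staircase n).hor.Hom A B)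
    (g : (staircase n).hor.Hom A' B') (v : (staircase n).ver.Hom A A')
    (w : (staircase n).ver.Hom B B') :
    D.Sq (mixHor F h f) (mixHor F h' g) (mixVer F hk v) (mixVer F hl w) := by
  subst h h'
  exact D.sq_vcomp ((F.obj k).map_sq trivial) (VertNatTrans.square (F.map (homOfLE hk)) g)

theorem mixHor_sq {k l k' l' : K} (h : k = l) (h' : k' = l') (hk : k ≤ k') (hl : l ≤ l')
    {A B : (staircase n).Obj} (f : (staircase n).hor.Hom A B) :
    D.Sq (mixHor F h f) (mixHor F h' f) (VertNatTrans.app (F.map (homOfLE hk)) A)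
      (VertNatTrans.app (F.map (homOfLE hl)) B) := by
  subst h h'
  exact VertNatTrans.square (F.map (homOfLE hk)) f

theorem mixVer_naturality {k l k' l' : K} (h : k ≤ l) (h' : k' ≤ l') (hk : k ≤ k') (hl : l ≤ l')
    {A B : (staircase n).Obj} (v : (staircase n).ver.Hom A B) :
    D.ver.comp (mixVer F h v) (VertNatTrans.app (F.map (homOfLE hl)) B) =
      D.ver.comp (VertNatTrans.app (F.map (homOfLE hk)) A) (mixVer F h' v) := by
  simp only [mixVer]
  rw [D.ver.assoc, map_homOfLE_comp_app, ← D.ver.assoc, ← VertNatTrans.naturality, D.ver.assoc,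
    map_homOfLE_comp_app]

/-- The double functor whose row `i` is the row `i` of the member `θ i` of a chain of double
functors. -/
def mix (θ : Fin (n + 1) →o K) : DoubleFunctor (staircase n) D where
  obj p := (F.obj (θ p.1.1)).obj p
  hmap f := mixHor F (congrArg θ f.down.1) f
  vmap v := mixVer F (θ.monotone v.down.1) v
  hmap_id _ := (F.obj _).hmap_id _
  hmap_comp _ _ := (mixHor_comp F _ _ _ _).symm
  vmap_id _ := (mixVer_refl F _ _).trans ((F.obj _).vmap_id _)
  vmap_comp _ _ := (mixVer_comp F _ _ _ _).symm
  map_sq _ := mix_sq F _ _ _ _ _ _ _ _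

/-- The vertical transformation between mixed double functors for comparable parameters. -/
def mixMap {θ θ' : Fin (n + 1) →o K} (h : θ ≤ θ') : mix F θ ⟶ mix F θ' where
  app p := VertNatTrans.app (F.map (homOfLE (h p.1.1))) p
  square f := mixHor_sq F (congrArg θ f.down.1) (congrArg θ' f.down.1) _ _ f
  naturality v := mixVer_naturality F _ _ _ _ v

theorem mixMap_refl {θ : Fin (n + 1) →o K} (h : θ ≤ θ) : mixMap F h = 𝟙 (mix F θ) := by
  apply VertNatTrans.ext
  funext A
  exact map_homOfLE_refl_app F (h A.1.1) A

theorem mixMap_comp {θ θ' θ'' : Fin (n + 1) →o K} (h : θ ≤ θ') (h' : θ' ≤ θ'') :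
    mixMap F h ≫ mixMap F h' = mixMap F (h.trans h') := by
  apply VertNatTrans.ext
  funext A
  exact map_homOfLE_comp_app F (h A.1.1) (h' A.1.1) A

theorem DoubleFunctor.hext {I : FlatDoubleCat.{0}} {G G' : DoubleFunctor I D}
    (ho : G.obj = G'.obj) (hh : HEq (@G.hmap) (@G'.hmap)) (hv : HEq (@G.vmap) (@G'.vmap)) :
    G = G' := by
  cases G
  cases G'
  cases ho
  cases hh
  cases hv
  rfl

theorem mix_of_eq (θ : Fin (n + 1) →o K) (k : K) (h : ∀ i, θ i = k) : mix F θ = F.obj k := by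
  obtain rfl : θ = OrderHom.const _ k := OrderHom.ext _ _ (funext h)
  refine DoubleFunctor.hext rfl HEq.rfl (heq_of_eq ?_)
  funext A B v
  exact mixVer_refl F (le_refl k) v

theorem mix_const_obj (G : DoubleFunctor (staircase n) D) (θ : Fin (n + 1) →o K) :
    mix ((Functor.const K).obj G) θ = G := by
  refine DoubleFunctor.hext rfl HEq.rfl (heq_of_eq ?_)
  funext A B v
  exact D.ver.comp_id _

end Mixing

/-! ### Mixed chains in `S_n C` -/

section SCat

variable {C : SquaresCat.{u}} {n : ℕ} {J K : Type} [Preorder J] [Preorder K]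

/-- The object of `S_n C` whose row `i` is the row `i` of the member `θ i` of a chain. -/
def mixS (F : K ⥤ SCat C n) (θ : Fin (n + 1) →o K) : SCat C n :=
  ⟨mix (F ⋙ (diagonalAtO C n).ι) θ, fun i => (F.obj (θ i)).property i⟩

/-- The partial application of a monotone map of two variables. -/
def slice {I : Type} [Preorder I] (θ : J × I →o K) (j : J) : I →o K :=
  ⟨fun i => θ (j, i), fun _ _ h => θ.monotone ⟨le_rfl, h⟩⟩

theorem slice_mono {I : Type} [Preorder I] (θ : J × I →o K) {j j' : J} (h : j ≤ j') :
    slice θ j ≤ slice θ j' :=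
  fun _ => θ.monotone ⟨h, le_rfl⟩

/-- The chain in `S_n C` whose member `j` has as row `i` the row `i` of the member `θ (j, i)` of
a given chain. -/
def mixChain (F : K ⥤ SCat C n) (θ : J × Fin (n + 1) →o K) : J ⥤ SCat C n where
  obj j := mixS F (slice θ j)
  map f := ObjectProperty.homMk (mixMap (F ⋙ (diagonalAtO C n).ι) (slice_mono θ (leOfHom f)))
  map_id j := ObjectProperty.hom_ext _
    (mixMap_refl (F ⋙ (diagonalAtO C n).ι) (slice_mono θ (le_refl j)))
  map_comp f g := ObjectProperty.hom_ext _
    (mixMap_comp (F ⋙ (diagonalAtO C n).ι) (slice_mono θ (leOfHom f))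
      (slice_mono θ (leOfHom g))).symm

theorem SCat.hom_hext {X X' Y Y' : SCat C n} (hX : X = X') (hY : Y = Y') (f : X ⟶ Y)
    (f' : X' ⟶ Y') (h : ∀ A, HEq (VertNatTrans.app f.hom A) (VertNatTrans.app f'.hom A)) :
    HEq f f' := by
  subst hX hY
  exact heq_of_eq (ObjectProperty.hom_ext _
    (VertNatTrans.ext (funext fun A => eq_of_heq (h A))))

/-- Each member has a constant parameter and is left unchanged; this is the end of `homotopyFst` at
the identity. -/
theorem mixChain_fst (F : K ⥤ SCat C n) :
    mixChain F (OrderHom.fst : K × Fin (n + 1) →o K) = F := by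
  have h : ∀ k, (mixChain F (OrderHom.fst : K × Fin (n + 1) →o K)).obj k = F.obj k := fun k =>
    ObjectProperty.FullSubcategory.ext
      (mix_of_eq (F ⋙ (diagonalAtO C n).ι) (slice OrderHom.fst k) k fun _ => rfl)
  refine Functor.hext h fun k l f => ?_
  exact SCat.hom_hext (h k) (h l) _ _ fun A => HEq.rfl

/-- The rows chosen do not depend on the position in the chain, so all transitions are identities;
this is the end of `homotopySnd` at the retraction. -/
theorem mixChain_snd (F : K ⥤ SCat C n) (θ : Fin (n + 1) →o K) :
    mixChain F (θ.comp OrderHom.snd : J × Fin (n + 1) →o K) =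
      (Functor.const J).obj (mixS F θ) := by
  have h : ∀ {j j' : J} (f : j ⟶ j'),
      (mixChain F (θ.comp OrderHom.snd : J × Fin (n + 1) →o K)).map f = 𝟙 (mixS F θ) := fun f =>
    ObjectProperty.hom_ext _ (mixMap_refl (F ⋙ (diagonalAtO C n).ι) (le_refl θ))
  exact Functor.hext (fun _ => rfl) fun j j' f => heq_of_eq (h f)

theorem mixS_const_obj (x : SCat C n) (θ : Fin (n + 1) →o K) :
    mixS ((Functor.const K).obj x) θ = x :=
  ObjectProperty.FullSubcategory.ext (mix_const_obj x.obj θ)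

end SCat

/-! ### The retraction and the two homotopies -/

/-- The retraction of the diagonal nerve of `S_• C` onto the simplicial set of objects: row `i`
of the image of a chain is row `i` of its `i`-th member. -/
def obRetraction (C : SquaresCat.{u}) : diagNerve (SDot C) ⟶ obSSet (SDot C) where
  app n := ↾fun F => mixS (K := Fin (n.unop.len + 1)) F OrderHom.id
  -- For an operator `φ`, both ways round select row `φ i` of member `φ i`.
  naturality _ _ _ := rfl

theorem obInclusion_comp_obRetraction (C : SquaresCat.{u}) :
    obInclusion (SDot C) ≫ obRetraction C = 𝟙 _ := by
  ext n x
  exact mixS_const_obj (K := Fin (n.unop.len + 1)) x _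

/-- A natural family of operations on the rows of chains gives a simplicial homotopy. -/
def mixHomotopy (C : SquaresCat.{u})
    (θ : ∀ n : SimplexCategory, (n ⟶ ⦋1⦌) →
      (Fin (n.len + 1) × Fin (n.len + 1) →o Fin (n.len + 1)))
    (hθ : ∀ {m n : SimplexCategory} (φ : m ⟶ n) (β : n ⟶ ⦋1⦌) (k i : Fin (m.len + 1)),
      φ (θ m (φ ≫ β) (k, i)) = θ n β (φ k, φ i)) :
    SimplicialHomotopy (diagNerve (SDot C)) (diagNerve (SDot C)) where
  app n F β := mixChain (K := Fin (n.len + 1)) (J := Fin (n.len + 1)) F (θ n β)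
  naturality {m n} φ F β := by
    have h : φ.toOrderHom.comp (θ m (φ ≫ β)) =
        (θ n β).comp (OrderHom.prodMap φ.toOrderHom φ.toOrderHom) :=
      OrderHom.ext _ _ (funext fun p => hθ φ β p.1 p.2)
    -- On both sides, row `i` of member `k` is row `φ i` of the member of `F` with index `θ n β (φ
    -- k, φ i)`.
    exact congrArg (mixChain (K := Fin (n.len + 1)) (J := Fin (m.len + 1))
      (F ⋙ SCatMap C φ.toOrderHom)) h

/-- A monotone map of two variables that switches from `f` to `g ≥ f` along a map to `⦋1⦌`. -/
def switch {n : SimplexCategory} (β : n ⟶ ⦋1⦌)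
    {I : Type} [Preorder I] (f g : Fin (n.len + 1) × I →o Fin (n.len + 1)) (h : f ≤ g) :
    Fin (n.len + 1) × I →o Fin (n.len + 1) where
  toFun p := if β p.1 = 0 then f p else g p
  monotone' p q hpq := by
    have hβ : β p.1 ≤ β q.1 := β.toOrderHom.monotone hpq.1
    dsimp only
    split_ifs with h1 h2 h2
    · exact f.monotone hpq
    · exact (f.monotone hpq).trans (h q)
    · rw [h2] at hβ
      exact absurd (le_antisymm hβ (Fin.zero_le _)) h1
    · exact g.monotone hpq

/-- The maximum of two vertices, as a monotone map. -/
def maxHom (n : ℕ) : Fin (n + 1) × Fin (n + 1) →o Fin (n + 1) := OrderHom.fst ⊔ OrderHom.snd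

/-- The homotopy from the identity to the operation that replaces row `i` of member `k` of a
chain by the one of member `max k i`. -/
def homotopyFst (C : SquaresCat.{u}) :
    SimplicialHomotopy (diagNerve (SDot C)) (diagNerve (SDot C)) :=
  mixHomotopy C (fun n β => switch β OrderHom.fst (maxHom n.len) le_sup_left) (by
    intro m n φ β k i
    change φ (if β (φ k) = 0 then k else k ⊔ i) = if β (φ k) = 0 then φ k else φ k ⊔ φ i
    split_ifs
    · rfl
    -- Monotone maps of linear orders preserve `max`, which makes the common upper bound natural.
    · exact φ.toOrderHom.monotone.map_sup k i)

/-- The homotopy from the retraction to the operation that replaces row `i` of member `k` of a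
chain by the one of member `max k i`. -/
def homotopySnd (C : SquaresCat.{u}) :
    SimplicialHomotopy (diagNerve (SDot C)) (diagNerve (SDot C)) :=
  mixHomotopy C (fun n β => switch β OrderHom.snd (maxHom n.len) le_sup_right) (by
    intro m n φ β k i
    change φ (if β (φ k) = 0 then i else k ⊔ i) = if β (φ k) = 0 then φ i else φ k ⊔ φ i
    split_ifs
    · rfl
    · exact φ.toOrderHom.monotone.map_sup k i)

/-- The operation that replaces row `i` of member `k` of a chain by the one of member
`max k i`. -/
def maxMix (C : SquaresCat.{u}) : diagNerve (SDot C) ⟶ diagNerve (SDot C) where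
  app n := ↾fun F => mixChain (K := Fin (n.unop.len + 1)) (J := Fin (n.unop.len + 1)) F
    (maxHom n.unop.len)
  naturality m n φ := by
    ext F
    have h : φ.unop.toOrderHom.comp (maxHom n.unop.len) =
        (maxHom m.unop.len).comp (OrderHom.prodMap φ.unop.toOrderHom φ.unop.toOrderHom) :=
      OrderHom.ext _ _ (funext fun p => φ.unop.toOrderHom.monotone.map_sup p.1 p.2)
    exact congrArg (mixChain (K := Fin (m.unop.len + 1)) (J := Fin (n.unop.len + 1))
      (F ⋙ SCatMap C φ.unop.toOrderHom)) h

theorem homotopic_id_maxMix (C : SquaresCat.{u}) :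
    (SSet.toTop.map (𝟙 (diagNerve (SDot C)))).hom.Homotopic (SSet.toTop.map (maxMix C)).hom :=
  (homotopyFst C).homotopic_realization _ _
    (fun _ F => mixChain_fst F) (fun _ _ => rfl)

theorem homotopic_obRetraction_maxMix (C : SquaresCat.{u}) :
    (SSet.toTop.map (obRetraction C ≫ obInclusion (SDot C))).hom.Homotopic
      (SSet.toTop.map (maxMix C)).hom :=
  (homotopySnd C).homotopic_realization _ _
    (fun n F => mixChain_snd (J := Fin (n.len + 1)) F OrderHom.id) (fun _ _ => rfl)

/-- For every squares category the realization of `S_• C` is homotopy equivalent to that of its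
simplicial set of objects. -/
noncomputable def realizeHomotopyEquiv (C : SquaresCat.{u}) :
    ContinuousMap.HomotopyEquiv (realizeSCat (SDot C)) (realizeOb (SDot C)) where
  toFun := (SSet.toTop.map (obRetraction C)).hom
  invFun := realizeObInclusion (SDot C)
  left_inv := by
    have h := (homotopic_obRetraction_maxMix C).trans (homotopic_id_maxMix C).symm
    rw [Functor.map_comp, CategoryTheory.Functor.map_id] at h
    exact h
  right_inv := by
    have h : SSet.toTop.map (obInclusion (SDot C)) ≫ SSet.toTop.map (obRetraction C) = 𝟙 _ := by
      rw [← Functor.map_comp, obInclusion_comp_obRetraction, CategoryTheory.Functor.map_id]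
    have h' := congrArg TopCat.Hom.hom h
    change ((SSet.toTop.map (obRetraction C)).hom.comp
      (SSet.toTop.map (obInclusion (SDot C))).hom).Homotopic _
    rw [← TopCat.hom_comp, h']
    exact ContinuousMap.Homotopic.refl _

/-- The equivalence holds for every squares category: mixing the rows of a chain only uses
composition with the vertical transformations of the chain, so no vertical morphism has to be
inverted and the hypothesis `hC` is not needed. -/
theorem mainTheorem7 (C : SquaresCat.{u})
    (hC : ∀ (A B : C.Obj) (w : C.ver.Hom A B),
      C.IsVertWeakEquiv w ↔ @CategoryTheory.IsIso C.Obj C.ver A B w) :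
    ∃ e : ContinuousMap.HomotopyEquiv (realizeSCat (SDot C)) (realizeOb (SDot C)),
      e.invFun = realizeObInclusion (SDot C) :=
  ⟨realizeHomotopyEquiv C, rfl⟩
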